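/- Let $A$ be an artin algebra and $n\ge 2$. For integers $a\le b$ let $\mathbf{C}_{[a,b]}(\mathrm{proj}\,A)$ be the full subcategory of cochain complexes $X=(X^i,d^i)_{i\in\mathbb Z}$ of $A$-modules with every $X^i$ finitely generated projective and $X^i=0$ for $i\notin[a,b]$; put $\mathbf{C}_n(\mathrm{proj}\,A)=\mathbf{C}_{[1,n]}(\mathrm{proj}\,A)$. Let $F:\mathbf{C}_{[0,n]}(\mathrm{proj}\,A)\to\mathbf{C}_n(\mathrm{proj}\,A)$ and $G:\mathbf{C}_{[0,n]}(\mathrm{proj}\,A)\to\mathbf{C}_{[0,n-1]}(\mathrm{proj}\,A)$ be the hard truncation functors, which delete the entry in degree $0$, respectively in degree $n$. A morphism $f$ is irreducible if it is neither a section nor a retraction and, whenever $f=hg$, either $g$ is a section or $h$ is a retraction. The radical of these categories is the ideal generated by the non-isomorphisms between indecomposable objects, and a morphism is radical-irreducible if it is irreducible and lies in the radical. If $W$ is an indecomposable complex in $\mathbf{C}_n(\mathrm{proj}\,A)$, a left enlargement of $W$ is an indecomposable complex $Z$ in $\mathbf{C}_{[0,n]}(\mathrm{proj}\,A)$ such that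 $Z^0\ne0$ and $W$ is a direct summand of $F(Z)$. A stalk injective complex is a complex in $\mathbf{C}_{[0,n]}(\mathrm{proj}\,A)$ with exactly one nonzero entry which is an injective object for the exact structure given by the degreewise split short exact sequences. **Proposition.** Let $X$ and $Y$ be indecomposable complexes in $\mathbf{C}_{[0,n]}(\mathrm{proj}\,A)$ with $X^0\neq0$ and $Y^0\neq0$, and let $f:X\to Y$ be an irreducible morphism in $\mathbf{C}_{[0,n]}(\mathrm{proj}\,A)$. (a) If neither $X$ nor $Y$ is a stalk injective complex, then at least one of the following holds: there is an indecomposable complex $W$ in $\mathbf{C}_n(\mathrm{proj}\,A)$ such that $X$ and $Y$ are two non-isomorphic left enlargements of $W$; or $F(f)$ is radical-irreducible in $\mathbf{C}_n(\mathrm{proj}\,A)$ and $f^0:X^0\to Y^0$ is a retraction. (b) If $X$ or $Y$ is a stalk injective complex, then $G(f)$ is an irreducible morphism in $\mathbf{C}_{[0,n-1]}(\mathrm{proj}\,A)$. -/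

import Mathlib

open CategoryTheory CategoryTheory.Limits

universe u w

section General

variable {C : Type*} [Category* C]

/-- `f` is irreducible if it is neither a section nor a retraction and, for every factorization
`f = h ∘ g`, either `g` is a section or `h` is a retraction. -/
def IsIrreducibleHom {X Y : C} (f : X ⟶ Y) : Prop :=
  ¬ IsSplitMono f ∧ ¬ IsSplitEpi f ∧
    ∀ ⦃Z : C⦄ (g : X ⟶ Z) (h : Z ⟶ Y), g ≫ h = f → IsSplitMono g ∨ IsSplitEpi h

variable [Preadditive C] [HasBinaryBiproducts C]

/-- `W` is a direct summand of `X`: there is a complement `W'` with `X ≅ W ⊕ W'`. -/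
def IsDirectSummand (W X : C) : Prop :=
  ∃ W' : C, Nonempty (X ≅ W ⊞ W')

/-- The Jacobson radical `ℜ(X, Y)` of a (Krull-Schmidt) category: the ideal generated by the
non-isomorphisms between indecomposable objects. Its elements are the finite sums of morphisms
`X ⟶ Z ⟶ W ⟶ Y` whose middle factor is a non-isomorphism between indecomposable objects. -/
def radicalHom (X Y : C) : AddSubgroup (X ⟶ Y) :=
  AddSubgroup.closure {f | ∃ (Z W : C) (a : X ⟶ Z) (g : Z ⟶ W) (b : W ⟶ Y),
    Indecomposable Z ∧ Indecomposable W ∧ ¬ IsIso g ∧ a ≫ g ≫ b = f}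

/-- A radical-irreducible morphism: a morphism in the radical which is also irreducible. -/
def IsRadicalIrreducible {X Y : C} (f : X ⟶ Y) : Prop :=
  f ∈ radicalHom X Y ∧ IsIrreducibleHom f

end General

section Complexes

variable (A : Type u) [Ring A]

/-- The property of a cochain complex `X` of `A`-modules of lying in `C_[m,n](proj A)`: every `X^i`
is a finitely generated projective module, and `X^i = 0` for `i ∉ [m, n]`. -/
def isFixedSizeProj (m n : ℤ) : ObjectProperty (CochainComplex (ModuleCat.{u} A) ℤ) := fun X ↦
  (∀ i, Module.Finite A (X.X i) ∧ Module.Projective A (X.X i)) ∧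
    ∀ i, i ∉ Set.Icc m n → IsZero (X.X i)

/-- The category `C_[m,n](proj A)` of complexes of fixed size, a full subcategory of the category
of cochain complexes of `A`-modules. -/
abbrev FixedSize (m n : ℤ) : Type _ := (isFixedSizeProj A m n).FullSubcategory

variable {A}

theorem isFixedSizeProj_biprod {m n : ℤ} {K L : CochainComplex (ModuleCat.{u} A) ℤ}
    (hK : isFixedSizeProj A m n K) (hL : isFixedSizeProj A m n L) :
    isFixedSizeProj A m n (K ⊞ L) := by
  have e (i : ℤ) : (K ⊞ L).X i ≅ ModuleCat.of A (K.X i × L.X i) :=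
    HomologicalComplex.biprodXIso K L i ≪≫ ModuleCat.biprodIsoProd _ _
  refine ⟨fun i ↦ ?_, fun i hi ↦ ?_⟩
  · have h1 := hK.1 i
    have h2 := hL.1 i
    have := h1.1
    have := h1.2
    have := h2.1
    have := h2.2
    exact ⟨Module.Finite.equiv (e i).symm.toLinearEquiv,
      Module.Projective.of_equiv (e i).symm.toLinearEquiv⟩
  · have h1 := ModuleCat.subsingleton_of_isZero (hK.2 i hi)
    have h2 := ModuleCat.subsingleton_of_isZero (hL.2 i hi)
    exact (ModuleCat.isZero_of_subsingleton (ModuleCat.of A (K.X i × L.X i))).of_iso (e i)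

instance instHasBinaryBiproductsFixedSize (m n : ℤ) : HasBinaryBiproducts (FixedSize A m n) where
  has_binary_biproduct X Y := by
    let P := isFixedSizeProj A m n
    exact HasBinaryBiproduct.mk
      { bicone :=
          { pt := ⟨X.obj ⊞ Y.obj, isFixedSizeProj_biprod X.property Y.property⟩
            fst := P.homMk biprod.fst
            snd := P.homMk biprod.snd
            inl := P.homMk biprod.inl
            inr := P.homMk biprod.inr }
        isBilimit := isBinaryBilimitOfTotal _ (by
          ext1
          exact biprod.total) }

theorem isFixedSizeProj_stupidTrunc {ι : Type*} {c : ComplexShape ι}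
    (e : c.Embedding (ComplexShape.up ℤ)) [e.IsRelIff] {m n a b : ℤ}
    (he : ∀ j : ι, e.f j ∈ Set.Icc m n → e.f j ∈ Set.Icc a b)
    {K : CochainComplex (ModuleCat.{u} A) ℤ} (hK : isFixedSizeProj A m n K) :
    isFixedSizeProj A a b (K.stupidTrunc e) := by
  refine ⟨fun i ↦ ?_, fun i hi ↦ ?_⟩
  · by_cases h : ∃ j, e.f j = i
    · obtain ⟨j, hj⟩ := h
      have := (hK.1 i).1
      have := (hK.1 i).2
      exact ⟨Module.Finite.equiv (K.stupidTruncXIso e hj).symm.toLinearEquiv,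
        Module.Projective.of_equiv (K.stupidTruncXIso e hj).symm.toLinearEquiv⟩
    · have := ModuleCat.subsingleton_of_isZero
        (K.isZero_stupidTrunc_X e i (fun j hj ↦ h ⟨j, hj⟩))
      exact ⟨inferInstance, inferInstance⟩
  · by_cases h : ∃ j, e.f j = i
    · obtain ⟨j, rfl⟩ := h
      exact (hK.2 _ (fun h' ↦ hi (he j h'))).of_iso (K.stupidTruncXIso e rfl)
    · exact K.isZero_stupidTrunc_X e i (fun j hj ↦ h ⟨j, hj⟩)

/-- The left hard truncation `C_[m,n](proj A) ⥤ C_[a,n](proj A)`, which keeps the entries and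
differentials in degrees `≥ a` and puts `0` in degrees `< a`. -/
noncomputable def truncGEFunctor (m n a : ℤ) : FixedSize A m n ⥤ FixedSize A a n :=
  (isFixedSizeProj A a n).lift
    ((isFixedSizeProj A m n).ι ⋙
      (ComplexShape.embeddingUpIntGE a).stupidTruncFunctor (ModuleCat.{u} A))
    (fun X ↦ isFixedSizeProj_stupidTrunc (ComplexShape.embeddingUpIntGE a)
      (fun j hj ↦ ⟨by change a ≤ a + (j : ℤ); omega, hj.2⟩) X.property)

/-- The right hard truncation `C_[m,n](proj A) ⥤ C_[m,b](proj A)`, which keeps the entries and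
differentials in degrees `≤ b` and puts `0` in degrees `> b`. -/
noncomputable def truncLEFunctor (m n b : ℤ) : FixedSize A m n ⥤ FixedSize A m b :=
  (isFixedSizeProj A m b).lift
    ((isFixedSizeProj A m n).ι ⋙
      (ComplexShape.embeddingUpIntLE b).stupidTruncFunctor (ModuleCat.{u} A))
    (fun X ↦ isFixedSizeProj_stupidTrunc (ComplexShape.embeddingUpIntLE b)
      (fun j hj ↦ ⟨hj.1, by change b - (j : ℤ) ≤ b; omega⟩) X.property)

/-- The functor `F : C_[0,n](proj A) ⥤ C_n(proj A) = C_[1,n](proj A)`. -/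
noncomputable abbrev functorF (n : ℤ) : FixedSize A 0 n ⥤ FixedSize A 1 n :=
  truncGEFunctor 0 n 1

/-- The functor `G : C_[0,n](proj A) ⥤ C_[0,n-1](proj A)`. -/
noncomputable abbrev functorG (n : ℤ) : FixedSize A 0 n ⥤ FixedSize A 0 (n - 1) :=
  truncLEFunctor 0 n (n - 1)

/-- `Z` is a left enlargement of the indecomposable complex `X` of `C_n(proj A)`: `Z` is an
indecomposable complex of `C_[0,n](proj A)`, `Z^0 ≠ 0`, and `X` is a direct summand of `F(Z)`. -/
def IsLeftEnlargement {n : ℤ} (X : FixedSize A 1 n) (Z : FixedSize A 0 n) : Prop :=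
  Indecomposable X ∧ Indecomposable Z ∧ ¬ IsZero (Z.obj.X 0) ∧
    IsDirectSummand X ((functorF n).obj Z)

/-- A stalk complex: exactly one entry is nonzero. -/
def IsStalk {m n : ℤ} (X : FixedSize A m n) : Prop :=
  ∃ i, ¬ IsZero (X.obj.X i) ∧ ∀ j, j ≠ i → IsZero (X.obj.X j)

/-- Injective objects of `C_[m,n](proj A)` for its exact structure, whose conflations are the
degreewise split short exact sequences: every morphism into `I` extends along every degreewise
split monomorphism. -/
def IsInjectiveComplex {m n : ℤ} (I : FixedSize A m n) : Prop :=
  ∀ ⦃U V : FixedSize A m n⦄ (s : U ⟶ V), (∀ i, IsSplitMono (s.hom.f i)) →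
    ∀ g : U ⟶ I, ∃ h : V ⟶ I, s ≫ h = g

/-- A stalk injective complex: a stalk complex which is injective in `C_[m,n](proj A)`. -/
def IsStalkInjective {m n : ℤ} (X : FixedSize A m n) : Prop :=
  IsStalk X ∧ IsInjectiveComplex X

end Complexes

/-!
A factorization of `F(f)` through `Z` glues to a factorization of `f`: push out along the inclusion
`F(X) ⟶ X`. Dually, a factorization of `G(f)` lifts by pulling back along the projection
`Y ⟶ G(Y)`. Hence a truncation of an irreducible morphism is irreducible unless it splits.

If `F(f)` splits, or if `F(f)` is not in the radical, then `F(X)` and `F(Y)` have an indecomposable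
direct summand in common. Lifting the trivial factorization `F(f) = 𝟙 ∘ F(f)` shows moreover that
either `F(f)` is a section or `f^0` is a retraction. This excludes `X ≅ Y`: by Fitting's lemma, a
non-invertible endomorphism of `X` is nilpotent, so it can be neither a section on `F(X) ≠ 0` nor a
retraction on `X^0 ≠ 0`.

For part (b), an indecomposable complex with `X^0 ≠ 0` and `X^1 = 0` is concentrated in degree `0`.
If `X` or `Y` is a stalk and `G(f)` is a section or a retraction, this applies to `X` or to `Y`
respectively, and the splitting of `G(f)` lifts to one of `f`.
-/

section Retracts

variable {C : Type*} [Category* C] [Preadditive C] [HasBinaryBiproducts C]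

theorem exists_iso_biprod_of_retract [IsIdempotentComplete C] {W X : C} (h : Retract W X) :
    ∃ (W' : C) (e : X ≅ W ⊞ W'), biprod.inl ≫ e.inv = h.i := by
  obtain ⟨W', k, q, hkq, hqk⟩ :=
    IsIdempotentComplete.idempotents_split X (𝟙 X - h.r ≫ h.i) (by simp)
  have hiq : h.i ≫ q = 0 := by
    rw [← Category.comp_id q, ← hkq, reassoc_of% hqk]
    simp
  have hkr : k ≫ h.r = 0 := by
    rw [← Category.id_comp k, ← hkq, Category.assoc, Category.assoc, reassoc_of% hqk]
    simp
  let e : X ≅ W ⊞ W' :=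
    { hom := biprod.lift h.r q
      inv := biprod.desc h.i k
      hom_inv_id := by simp [hqk]
      inv_hom_id := by ext <;> simp [hkq, hiq, hkr] }
  exact ⟨W', e, biprod.inl_desc _ _⟩

theorem isDirectSummand_of_retract [IsIdempotentComplete C] {W X : C} (h : Retract W X) :
    IsDirectSummand W X :=
  let ⟨W', e, _⟩ := exists_iso_biprod_of_retract h
  ⟨W', ⟨e⟩⟩

theorem isZero_or_isIso_of_retract [IsIdempotentComplete C] {W X : C} (hX : Indecomposable X)
    (h : Retract W X) : IsZero W ∨ IsIso h.i := by
  obtain ⟨W', e, he⟩ := exists_iso_biprod_of_retract h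
  refine (hX.2 W W' e).imp_right fun hW' ↦ ?_
  have : IsIso (biprod.inl : W ⟶ W ⊞ W') := (isoBiprodZero hW').isIso_hom
  rw [← he]
  infer_instance

/-- The categorical form of Fitting's lemma: `i` makes `I` a direct summand of `X`. -/
theorem isIso_or_eq_zero_of_isIso_comp [IsIdempotentComplete C] {X I : C} (hX : Indecomposable X)
    (p : X ⟶ I) (i : I ⟶ X) [IsIso (i ≫ p)] : IsIso (p ≫ i) ∨ p ≫ i = 0 := by
  let h : Retract I X := ⟨i, p ≫ inv (i ≫ p), by simp [← Category.assoc]⟩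
  rcases isZero_or_isIso_of_retract hX h with hI | (hi : IsIso i)
  · exact Or.inr (by rw [hI.eq_of_tgt p 0, zero_comp])
  · have : IsIso p := IsIso.of_isIso_comp_left i p
    exact Or.inl inferInstance

end Retracts

section Radical

variable {C : Type*} [Category* C] [Preadditive C] [HasBinaryBiproducts C] {X Y Z : C}

theorem comp_mem_radicalHom (a : X ⟶ Y) {φ : Y ⟶ Z} (hφ : φ ∈ radicalHom Y Z) :
    a ≫ φ ∈ radicalHom X Z := by
  have h : radicalHom Y Z ≤ (radicalHom X Z).comap (Preadditive.leftComp Z a) := by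
    refine (AddSubgroup.closure_le _).2 ?_
    rintro _ ⟨U, V, s, g, t, hU, hV, hg, rfl⟩
    exact AddSubgroup.subset_closure ⟨U, V, a ≫ s, g, t, hU, hV, hg, Category.assoc _ _ _⟩
  exact h hφ

theorem mem_radicalHom_comp {φ : X ⟶ Y} (hφ : φ ∈ radicalHom X Y) (b : Y ⟶ Z) :
    φ ≫ b ∈ radicalHom X Z := by
  have h : radicalHom X Y ≤ (radicalHom X Z).comap (Preadditive.rightComp X b) := by
    refine (AddSubgroup.closure_le _).2 ?_
    rintro _ ⟨U, V, s, g, t, hU, hV, hg, rfl⟩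
    exact AddSubgroup.subset_closure
      ⟨U, V, s, g, t ≫ b, hU, hV, hg, by simp [Preadditive.rightComp]⟩
  exact h hφ

theorem isIso_of_notMem_radicalHom (hX : Indecomposable X) (hY : Indecomposable Y) {φ : X ⟶ Y}
    (hφ : φ ∉ radicalHom X Y) : IsIso φ := by
  by_contra h
  exact hφ (AddSubgroup.subset_closure ⟨X, Y, 𝟙 X, φ, 𝟙 Y, hX, hY, h, by simp⟩)

end Radical

/-- A size function with the properties of the length of a module: it is additive on biproducts and
positive on nonzero objects. Its existence guarantees decompositions into indecomposables. -/
structure AdditiveSize (C : Type*) [Category* C] [Preadditive C] [HasBinaryBiproducts C] where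
  size : C → ℕ
  size_pos : ∀ X, ¬ IsZero X → 0 < size X
  size_biprod : ∀ {X Y Z : C}, (X ≅ Y ⊞ Z) → size X = size Y + size Z

namespace AdditiveSize

variable {C : Type*} [Category* C] [Preadditive C] [HasBinaryBiproducts C]

theorem induction_on_indecomposable (ℓ : AdditiveSize C) {P : C → Prop}
    (zero : ∀ X, IsZero X → P X) (indecomposable : ∀ X, Indecomposable X → P X)
    (sum : ∀ X Y Z (s : Retract Y X) (t : Retract Z X), s.r ≫ s.i + t.r ≫ t.i = 𝟙 X →
      P Y → P Z → P X) (X : C) : P X := by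
  induction hs : ℓ.size X using Nat.strong_induction_on generalizing X with
  | _ s ih =>
    subst hs
    by_cases hX0 : IsZero X
    · exact zero X hX0
    by_cases hX : Indecomposable X
    · exact indecomposable X hX
    obtain ⟨Y, Z, e, hY, hZ⟩ : ∃ Y Z, ∃ _ : X ≅ Y ⊞ Z, ¬ IsZero Y ∧ ¬ IsZero Z := by
      by_contra! h
      exact hX ⟨hX0, fun Y Z e ↦ or_iff_not_imp_left.2 (h Y Z e)⟩
    have hsize := ℓ.size_biprod e
    have hYpos := ℓ.size_pos Y hY
    have hZpos := ℓ.size_pos Z hZ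
    refine sum X Y Z ⟨biprod.inl ≫ e.inv, e.hom ≫ biprod.fst, by simp⟩
      ⟨biprod.inr ≫ e.inv, e.hom ≫ biprod.snd, by simp⟩ ?_
      (ih _ (by omega) Y rfl) (ih _ (by omega) Z rfl)
    calc (e.hom ≫ biprod.fst) ≫ biprod.inl ≫ e.inv + (e.hom ≫ biprod.snd) ≫ biprod.inr ≫ e.inv
      _ = e.hom ≫ (biprod.fst ≫ biprod.inl + biprod.snd ≫ biprod.inr) ≫ e.inv := by
        simp only [Category.assoc, Preadditive.comp_add, Preadditive.add_comp]
      _ = 𝟙 X := by rw [biprod.total, Category.id_comp, e.hom_inv_id]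

theorem exists_indecomposable_retract (ℓ : AdditiveSize C) {X : C} (hX : ¬ IsZero X) :
    ∃ W, Indecomposable W ∧ Nonempty (Retract W X) := by
  induction X using ℓ.induction_on_indecomposable with
  | zero X h => exact absurd h hX
  | indecomposable X h => exact ⟨X, h, ⟨.refl X⟩⟩
  | sum X Y Z s t hst ihY ihZ =>
    by_cases hY : IsZero Y
    · have hZ : ¬ IsZero Z := fun hZ ↦ hX <| (IsZero.iff_id_eq_zero X).2 <| by
        rw [← hst, hY.eq_of_tgt s.r 0, hZ.eq_of_tgt t.r 0, zero_comp, zero_comp, add_zero]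
      obtain ⟨W, hW, ⟨u⟩⟩ := ihZ hZ
      exact ⟨W, hW, ⟨u.trans t⟩⟩
    · obtain ⟨W, hW, ⟨u⟩⟩ := ihY hY
      exact ⟨W, hW, ⟨u.trans s⟩⟩

theorem nonempty_retract_of_notMem_radicalHom (ℓ : AdditiveSize C) {X Y : C}
    (hX : Indecomposable X) {φ : X ⟶ Y} (hφ : φ ∉ radicalHom X Y) : Nonempty (Retract X Y) := by
  induction Y using ℓ.induction_on_indecomposable with
  | zero Y hY => exact absurd (hY.eq_of_tgt φ 0 ▸ zero_mem _) hφ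
  | indecomposable Y hY =>
    have := isIso_of_notMem_radicalHom hX hY hφ
    exact ⟨.ofIso (asIso φ)⟩
  | sum Y Y₁ Y₂ s t hst ih₁ ih₂ =>
    have hsum : (φ ≫ s.r) ≫ s.i + (φ ≫ t.r) ≫ t.i = φ := by
      rw [Category.assoc, Category.assoc, ← Preadditive.comp_add, hst, Category.comp_id]
    by_cases h₁ : φ ≫ s.r ∈ radicalHom X Y₁
    · have h₂ : φ ≫ t.r ∉ radicalHom X Y₂ := fun h₂ ↦ hφ <| hsum ▸
        add_mem (mem_radicalHom_comp h₁ _) (mem_radicalHom_comp h₂ _)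
      exact (ih₂ h₂).map (·.trans t)
    · exact (ih₁ h₁).map (·.trans s)

theorem exists_common_retract_of_notMem_radicalHom (ℓ : AdditiveSize C) {X Y : C} {φ : X ⟶ Y}
    (hφ : φ ∉ radicalHom X Y) :
    ∃ W, Indecomposable W ∧ Nonempty (Retract W X) ∧ Nonempty (Retract W Y) := by
  induction X using ℓ.induction_on_indecomposable with
  | zero X hX => exact absurd (hX.eq_of_src φ 0 ▸ zero_mem _) hφ
  | indecomposable X hX =>
    exact ⟨X, hX, ⟨.refl X⟩, ℓ.nonempty_retract_of_notMem_radicalHom hX hφ⟩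
  | sum X X₁ X₂ s t hst ih₁ ih₂ =>
    have hsum : s.r ≫ s.i ≫ φ + t.r ≫ t.i ≫ φ = φ := by
      rw [← Category.assoc, ← Category.assoc, ← Preadditive.add_comp, hst, Category.id_comp]
    by_cases h₁ : s.i ≫ φ ∈ radicalHom X₁ Y
    · have h₂ : t.i ≫ φ ∉ radicalHom X₂ Y := fun h₂ ↦ hφ <| hsum ▸
        add_mem (comp_mem_radicalHom _ h₁) (comp_mem_radicalHom _ h₂)
      obtain ⟨W, hW, hWX, hWY⟩ := ih₂ h₂
      exact ⟨W, hW, hWX.map (·.trans t), hWY⟩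
    · obtain ⟨W, hW, hWX, hWY⟩ := ih₁ h₁
      exact ⟨W, hW, hWX.map (·.trans s), hWY⟩

end AdditiveSize

section Nilpotent

variable {C : Type*} [Category* C] [Preadditive C] {X : C} {θ : End X}

theorem isNilpotent_mapEnd {D : Type*} [Category* D] [Preadditive D] (F : C ⥤ D)
    [F.PreservesZeroMorphisms] (hθ : IsNilpotent θ) : IsNilpotent (F.mapEnd X θ) := by
  obtain ⟨k, hk⟩ := hθ
  exact ⟨k, by rw [← map_pow, hk]; exact F.map_zero X X⟩

theorem isZero_of_isNilpotent_of_mono (hθ : IsNilpotent θ) (hm : Mono (θ : X ⟶ X)) :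
    IsZero X := by
  obtain ⟨k, hk⟩ := hθ
  have h : IsLeftRegular θ := fun _ _ h ↦ hm.right_cancellation _ _ h
  have h0 : IsLeftRegular (0 : End X) := hk ▸ h.pow k
  exact (IsZero.iff_id_eq_zero X).2 (h0 (by simp only [zero_mul]))

theorem isZero_of_isNilpotent_of_epi (hθ : IsNilpotent θ) (he : Epi (θ : X ⟶ X)) :
    IsZero X := by
  obtain ⟨k, hk⟩ := hθ
  have h : IsRightRegular θ := fun _ _ h ↦ he.left_cancellation _ _ h
  have h0 : IsRightRegular (0 : End X) := hk ▸ h.pow k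
  exact (IsZero.iff_id_eq_zero X).2 (h0 (by simp only [mul_zero]))

end Nilpotent

section StupidTruncation

variable {V : Type*} [Category* V] [HasZeroMorphisms V]

theorem exists_lift_of_degreewise {ι : Type*} {c : ComplexShape ι}
    {T S K : HomologicalComplex V c} (φ : T ⟶ K) (s : S ⟶ K) (h : ∀ i, ∃ ψ, ψ ≫ s.f i = φ.f i)
    (hm : ∀ i j, c.Rel i j → IsZero (T.X i) ∨ Mono (s.f j)) : ∃ ψ : T ⟶ S, ψ ≫ s = φ := by
  choose ψ hψ using h
  refine ⟨{ f := ψ, comm' := fun i j hij ↦ ?_ }, by ext i; exact hψ i⟩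
  rcases hm i j hij with h | h
  · exact h.eq_of_src _ _
  · rw [← cancel_mono (s.f j), Category.assoc, ← s.comm, reassoc_of% hψ i, Category.assoc, hψ j,
      φ.comm]

theorem exists_desc_of_degreewise {ι : Type*} {c : ComplexShape ι}
    {T S K : HomologicalComplex V c} (φ : T ⟶ S) (p : T ⟶ K) (h : ∀ i, ∃ ψ, p.f i ≫ ψ = φ.f i)
    (hm : ∀ i j, c.Rel i j → IsZero (S.X j) ∨ Epi (p.f i)) : ∃ ψ : K ⟶ S, p ≫ ψ = φ := by
  choose ψ hψ using h
  refine ⟨{ f := ψ, comm' := fun i j hij ↦ ?_ }, by ext i; exact hψ i⟩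
  rcases hm i j hij with h | h
  · exact h.eq_of_tgt _ _
  · rw [← cancel_epi (p.f i), reassoc_of% hψ i, p.comm_assoc, hψ j, φ.comm]

variable [HasZeroObject V]

theorem isIso_of_isIso_f_or_isZero {ι : Type*} {c : ComplexShape ι} {K L : HomologicalComplex V c}
    (φ : K ⟶ L) (h : ∀ i, IsIso (φ.f i) ∨ IsZero (K.X i) ∧ IsZero (L.X i)) : IsIso φ := by
  have (i : ι) : IsIso (φ.f i) :=
    (h i).elim id fun h ↦ isIso_of_source_target_iso_zero _ h.1.isoZero h.2.isoZero
  exact HomologicalComplex.Hom.isIso_of_components φ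

theorem stupidTrunc_d_comp_stupidTruncXIso_hom {ι ι' : Type*} {c : ComplexShape ι}
    {c' : ComplexShape ι'} (K : HomologicalComplex V c') (e : c.Embedding c') [e.IsRelIff]
    {i j : ι} {i' j' : ι'} (hi : e.f i = i') (hj : e.f j = j') :
    (K.stupidTrunc e).d i' j' ≫ (K.stupidTruncXIso e hj).hom =
      (K.stupidTruncXIso e hi).hom ≫ K.d i' j' := by
  change ((K.restriction e).extend e).d i' j' ≫
      ((K.restriction e).extendXIso e hj ≪≫ K.restrictionXIso e hj).hom =
    ((K.restriction e).extendXIso e hi ≪≫ K.restrictionXIso e hi).hom ≫ K.d i' j'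
  rw [HomologicalComplex.extend_d_eq _ e hi hj, HomologicalComplex.restriction_d_eq K e hi hj]
  simp only [Iso.trans_hom, Category.assoc, Iso.inv_hom_id_assoc, Iso.inv_hom_id, Category.comp_id]

theorem embeddingUpIntGE_f_toNat {a i : ℤ} (h : a ≤ i) :
    (ComplexShape.embeddingUpIntGE a).f (i - a).toNat = i := by
  change a + ((i - a).toNat : ℤ) = i
  omega

theorem embeddingUpIntLE_f_toNat {b i : ℤ} (h : i ≤ b) :
    (ComplexShape.embeddingUpIntLE b).f (b - i).toNat = i := by
  change b - ((b - i).toNat : ℤ) = i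
  omega

theorem isZero_stupidTruncGE_X (K : CochainComplex V ℤ) {a i : ℤ} (h : i < a) :
    IsZero ((K.stupidTrunc (ComplexShape.embeddingUpIntGE a)).X i) :=
  K.isZero_stupidTrunc_X _ i fun j hj ↦ by
    change a + (j : ℤ) = i at hj
    omega

theorem isZero_stupidTruncLE_X (K : CochainComplex V ℤ) {b i : ℤ} (h : b < i) :
    IsZero ((K.stupidTrunc (ComplexShape.embeddingUpIntLE b)).X i) :=
  K.isZero_stupidTrunc_X _ i fun j hj ↦ by
    change b - (j : ℤ) = i at hj
    omega

/-- The inclusion of the hard truncation in degrees `≥ a`. -/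
noncomputable def stupidTruncGEι (a : ℤ) (K : CochainComplex V ℤ) :
    K.stupidTrunc (ComplexShape.embeddingUpIntGE a) ⟶ K where
  f i := if h : a ≤ i then (K.stupidTruncXIso _ (embeddingUpIntGE_f_toNat h)).hom else 0
  comm' i j hij := by
    have hij' : i + 1 = j := hij
    by_cases hi : a ≤ i
    · have hj : a ≤ j := by omega
      simp only [hi, hj, dite_true]
      exact (stupidTrunc_d_comp_stupidTruncXIso_hom K _ _ _).symm
    · exact (isZero_stupidTruncGE_X K (by omega)).eq_of_src _ _

/-- The projection to the hard truncation in degrees `≤ b`. -/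
noncomputable def stupidTruncLEπ (b : ℤ) (K : CochainComplex V ℤ) :
    K ⟶ K.stupidTrunc (ComplexShape.embeddingUpIntLE b) where
  f i := if h : i ≤ b then (K.stupidTruncXIso _ (embeddingUpIntLE_f_toNat h)).inv else 0
  comm' i j hij := by
    have hij' : i + 1 = j := hij
    by_cases hj : j ≤ b
    · have hi : i ≤ b := by omega
      simp only [hi, hj, dite_true]
      rw [Iso.inv_comp_eq, ← Category.assoc, Iso.eq_comp_inv]
      exact stupidTrunc_d_comp_stupidTruncXIso_hom K _ _ _
    · exact (isZero_stupidTruncLE_X K (by omega)).eq_of_tgt _ _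

theorem isIso_stupidTruncGEι_f (K : CochainComplex V ℤ) {a i : ℤ} (h : a ≤ i) :
    IsIso ((stupidTruncGEι a K).f i) := by
  simp only [stupidTruncGEι, h, dite_true]
  infer_instance

theorem isIso_stupidTruncLEπ_f (K : CochainComplex V ℤ) {b i : ℤ} (h : i ≤ b) :
    IsIso ((stupidTruncLEπ b K).f i) := by
  simp only [stupidTruncLEπ, h, dite_true]
  infer_instance

theorem stupidTruncGEι_naturality {K L : CochainComplex V ℤ} (φ : K ⟶ L) (a : ℤ) :
    HomologicalComplex.stupidTruncMap φ (ComplexShape.embeddingUpIntGE a) ≫ stupidTruncGEι a L =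
      stupidTruncGEι a K ≫ φ := by
  ext i
  by_cases h : a ≤ i
  · simp [stupidTruncGEι, h]
  · exact (isZero_stupidTruncGE_X K (by omega)).eq_of_src _ _

theorem stupidTruncLEπ_naturality {K L : CochainComplex V ℤ} (φ : K ⟶ L) (b : ℤ) :
    φ ≫ stupidTruncLEπ b L = stupidTruncLEπ b K ≫
      HomologicalComplex.stupidTruncMap φ (ComplexShape.embeddingUpIntLE b) := by
  ext i
  by_cases h : i ≤ b
  · simp only [HomologicalComplex.comp_f, stupidTruncLEπ, h, dite_true]
    rw [Iso.eq_inv_comp, ← HomologicalComplex.stupidTruncMap_stupidTruncXIso_hom_assoc,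
      Iso.hom_inv_id, Category.comp_id]
  · exact (isZero_stupidTruncLE_X L (by omega)).eq_of_tgt _ _

end StupidTruncation

namespace FixedSize

variable {A : Type u} [Ring A] {m n : ℤ}

theorem isZero_X_of_lt (X : FixedSize A m n) {i : ℤ} (h : i < m) : IsZero (X.obj.X i) :=
  X.property.2 i fun hi ↦ h.not_ge hi.1

theorem isZero_X_of_gt (X : FixedSize A m n) {i : ℤ} (h : n < i) : IsZero (X.obj.X i) :=
  X.property.2 i fun hi ↦ h.not_ge hi.2

theorem isFixedSizeProj_of_le {m' n' : ℤ} (hm : m' ≤ m) (hn : n ≤ n')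
    {K : CochainComplex (ModuleCat.{u} A) ℤ} (hK : isFixedSizeProj A m n K) :
    isFixedSizeProj A m' n' K :=
  ⟨hK.1, fun i hi ↦ hK.2 i fun h ↦ hi ⟨hm.trans h.1, h.2.trans hn⟩⟩

theorem isFixedSizeProj_of_degreewise_retract {K : CochainComplex (ModuleCat.{u} A) ℤ}
    (h : ∀ i, ∃ L, isFixedSizeProj A m n L ∧ Nonempty (Retract (K.X i) (L.X i))) :
    isFixedSizeProj A m n K := by
  refine ⟨fun i ↦ ?_, fun i hi ↦ ?_⟩
  · obtain ⟨L, hL, ⟨s⟩⟩ := h i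
    have hs : s.r.hom ∘ₗ s.i.hom = LinearMap.id := by
      rw [← ModuleCat.hom_comp, s.retract, ModuleCat.hom_id]
    have := (hL.1 i).1
    have := (hL.1 i).2
    exact ⟨Module.Finite.of_surjective s.r.hom fun x ↦ ⟨s.i.hom x, LinearMap.congr_fun hs x⟩,
      Module.Projective.of_split _ _ hs⟩
  · obtain ⟨L, hL, ⟨s⟩⟩ := h i
    exact (hL.2 i hi).of_mono s.i

instance : (isFixedSizeProj A m n).IsStableUnderRetracts where
  of_retract s hL := isFixedSizeProj_of_degreewise_retract fun i ↦
    ⟨_, hL, ⟨s.map (HomologicalComplex.eval _ _ i)⟩⟩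

instance : IsIdempotentComplete (FixedSize A m n) where
  idempotents_split X p hp := by
    obtain ⟨K, i, r, hir, hri⟩ :=
      IsIdempotentComplete.idempotents_split X.obj p.hom (congrArg (·.hom) hp)
    have hK : isFixedSizeProj A m n K :=
      ObjectProperty.prop_of_retract _ ⟨i, r, hir⟩ X.property
    exact ⟨⟨K, hK⟩, ObjectProperty.homMk i, ObjectProperty.homMk r, by ext1; exact hir,
      by ext1; exact hri⟩

theorem isZero_iff (X : FixedSize A m n) : IsZero X ↔ ∀ i, IsZero (X.obj.X i) := by
  simp only [IsZero.iff_id_eq_zero]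
  refine ⟨fun h i ↦ congrArg (fun t : X ⟶ X ↦ t.hom.f i) h, fun h ↦ ?_⟩
  exact ObjectProperty.hom_ext _ (HomologicalComplex.hom_ext _ _ h)

end FixedSize

section LiftsFactorizations

variable {C D : Type*} [Category* C] [Category* D]

/-- Every factorization of `F.map f` is, up to an isomorphism of the middle object, the image of a
factorization of `f`. -/
def LiftsFactorizations (F : C ⥤ D) : Prop :=
  ∀ ⦃X Y : C⦄ (f : X ⟶ Y) ⦃Z : D⦄ (g : F.obj X ⟶ Z) (h : Z ⟶ F.obj Y), g ≫ h = F.map f →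
    ∃ (Z' : C) (g' : X ⟶ Z') (h' : Z' ⟶ Y) (e : Z ≅ F.obj Z'),
      g' ≫ h' = f ∧ g ≫ e.hom = F.map g' ∧ e.hom ≫ F.map h' = h

theorem IsIrreducibleHom.map {F : C ⥤ D} (hF : LiftsFactorizations F) {X Y : C} {f : X ⟶ Y}
    (hf : IsIrreducibleHom f) (hm : ¬ IsSplitMono (F.map f)) (he : ¬ IsSplitEpi (F.map f)) :
    IsIrreducibleHom (F.map f) := by
  refine ⟨hm, he, fun Z g h w ↦ ?_⟩
  obtain ⟨Z', g', h', e, hf', hg, rfl⟩ := hF f g h w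
  obtain rfl : g = F.map g' ≫ e.inv := by rw [← hg, Category.assoc, e.hom_inv_id, Category.comp_id]
  rcases hf.2.2 g' h' hf' with hg' | hh'
  · exact Or.inl inferInstance
  · exact Or.inr inferInstance

end LiftsFactorizations

namespace FixedSize

variable {A : Type u} [Ring A] {m n a b : ℤ}

/-- The inclusion of the left hard truncation into the whole complex. -/
noncomputable def truncGEι (a : ℤ) (X : FixedSize A m n) :
    ((truncGEFunctor m n a).obj X).obj ⟶ X.obj :=
  stupidTruncGEι a X.obj

/-- The projection of the whole complex to the right hard truncation. -/
noncomputable def truncLEπ (b : ℤ) (X : FixedSize A m n) :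
    X.obj ⟶ ((truncLEFunctor m n b).obj X).obj :=
  stupidTruncLEπ b X.obj

theorem truncGEι_naturality {X Y : FixedSize A m n} (f : X ⟶ Y) :
    ((truncGEFunctor m n a).map f).hom ≫ truncGEι a Y = truncGEι a X ≫ f.hom :=
  stupidTruncGEι_naturality f.hom a

theorem truncLEπ_naturality {X Y : FixedSize A m n} (f : X ⟶ Y) :
    f.hom ≫ truncLEπ b Y = truncLEπ b X ≫ ((truncLEFunctor m n b).map f).hom :=
  stupidTruncLEπ_naturality f.hom b

theorem isIso_truncGEι_f (X : FixedSize A m n) {i : ℤ} (h : a ≤ i) : IsIso ((truncGEι a X).f i) :=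
  isIso_stupidTruncGEι_f X.obj h

theorem isIso_truncLEπ_f (X : FixedSize A m n) {i : ℤ} (h : i ≤ b) : IsIso ((truncLEπ b X).f i) :=
  isIso_stupidTruncLEπ_f X.obj h

instance (X : FixedSize A m n) : Mono (truncGEι a X) :=
  HomologicalComplex.mono_of_mono_f _ fun i ↦ by
    rcases le_or_gt a i with h | h
    · have := isIso_truncGEι_f X h
      infer_instance
    · exact ⟨fun _ _ _ ↦ (isZero_X_of_lt _ h).eq_of_tgt _ _⟩

instance (X : FixedSize A m n) : Epi (truncLEπ b X) :=
  HomologicalComplex.epi_of_epi_f _ fun i ↦ by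
    rcases le_or_gt i b with h | h
    · have := isIso_truncLEπ_f X h
      infer_instance
    · exact ⟨fun _ _ _ ↦ (isZero_X_of_gt _ h).eq_of_src _ _⟩

theorem exists_iso_truncGE {Z : FixedSize A a n} {K : FixedSize A m n} (φ : Z.obj ⟶ K.obj)
    (hφ : ∀ i, a ≤ i → IsIso (φ.f i)) :
    ∃ e : Z ≅ (truncGEFunctor m n a).obj K, e.hom.hom ≫ truncGEι a K = φ := by
  have hι (i : ℤ) (hi : a ≤ i) := isIso_truncGEι_f K hi
  obtain ⟨ψ, hψ⟩ := exists_lift_of_degreewise φ (truncGEι a K)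
    (fun i ↦ by
      rcases le_or_gt a i with hi | hi
      · have := hι i hi
        exact ⟨φ.f i ≫ inv ((truncGEι a K).f i), by simp⟩
      · exact ⟨0, (isZero_X_of_lt Z hi).eq_of_src _ _⟩)
    (fun i j _ ↦ Or.inr inferInstance)
  have : IsIso ψ := isIso_of_isIso_f_or_isZero ψ fun i ↦ by
    rcases le_or_gt a i with hi | hi
    · have := hι i hi
      have : IsIso (ψ.f i ≫ (truncGEι a K).f i) := by
        rw [← HomologicalComplex.comp_f, hψ]
        exact hφ i hi
      exact Or.inl (IsIso.of_isIso_comp_right _ ((truncGEι a K).f i))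
    · exact Or.inr ⟨isZero_X_of_lt Z hi, isZero_X_of_lt _ hi⟩
  exact ⟨ObjectProperty.isoMk _ (asIso ψ), hψ⟩

section Pushout

variable {X : FixedSize A m n} {Z : FixedSize A a n}
  {g : ((truncGEFunctor m n a).obj X).obj ⟶ Z.obj} {P : CochainComplex (ModuleCat.{u} A) ℤ}
  {inl : X.obj ⟶ P} {inr : Z.obj ⟶ P}

theorem isIso_inr_f_of_isPushout (sq : IsPushout (truncGEι a X) g inl inr) {i : ℤ} (hi : a ≤ i) :
    IsIso (inr.f i) :=
  (sq.map (HomologicalComplex.eval _ _ i)).isIso_inr_of_isIso (isIso_truncGEι_f X hi)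

theorem isIso_inl_f_of_isPushout (sq : IsPushout (truncGEι a X) g inl inr) {i : ℤ} (hi : i < a) :
    IsIso (inl.f i) :=
  (sq.map (HomologicalComplex.eval _ _ i)).isIso_inl_of_isIso <|
    isIso_of_source_target_iso_zero _ (isZero_X_of_lt ((truncGEFunctor m n a).obj X) hi).isoZero
      (isZero_X_of_lt Z hi).isoZero

theorem isFixedSizeProj_of_isPushout (hma : m ≤ a) (sq : IsPushout (truncGEι a X) g inl inr) :
    isFixedSizeProj A m n P := isFixedSizeProj_of_degreewise_retract fun i ↦ by
  rcases le_or_gt a i with hi | hi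
  · have := isIso_inr_f_of_isPushout sq hi
    exact ⟨_, isFixedSizeProj_of_le hma le_rfl Z.property, ⟨.ofIso (asIso (inr.f i)).symm⟩⟩
  · have := isIso_inl_f_of_isPushout sq hi
    exact ⟨_, X.property, ⟨.ofIso (asIso (inl.f i)).symm⟩⟩

end Pushout

theorem exists_factorization_of_truncGE (hma : m ≤ a) {X Y : FixedSize A m n} (f : X ⟶ Y)
    {Z : FixedSize A a n} (g : (truncGEFunctor m n a).obj X ⟶ Z)
    (h : Z ⟶ (truncGEFunctor m n a).obj Y) (w : g ≫ h = (truncGEFunctor m n a).map f) :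
    ∃ (Z' : FixedSize A m n) (g' : X ⟶ Z') (h' : Z' ⟶ Y) (e : Z ≅ (truncGEFunctor m n a).obj Z'),
      g' ≫ h' = f ∧ g ≫ e.hom = (truncGEFunctor m n a).map g' ∧
      e.hom ≫ (truncGEFunctor m n a).map h' = h ∧ ∀ i < a, IsIso (g'.hom.f i) := by
  obtain ⟨P, inl, inr, sq⟩ : ∃ (P : _) (inl : X.obj ⟶ P) (inr : Z.obj ⟶ P),
    IsPushout (truncGEι a X) g.hom inl inr := ⟨_, _, _, IsPushout.of_hasPushout _ _⟩
  have w' : truncGEι a X ≫ f.hom = g.hom ≫ h.hom ≫ truncGEι a Y := by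
    rw [← truncGEι_naturality, ← w, ObjectProperty.FullSubcategory.comp_hom, Category.assoc]
  let Z' : FixedSize A m n := ⟨P, isFixedSizeProj_of_isPushout hma sq⟩
  let h' : Z' ⟶ Y := ObjectProperty.homMk (sq.desc _ _ w')
  obtain ⟨e, he⟩ := exists_iso_truncGE (K := Z') inr fun _ ↦ isIso_inr_f_of_isPushout sq
  refine ⟨Z', ObjectProperty.homMk inl, h', e, ?_, ?_, ?_, fun _ ↦ isIso_inl_f_of_isPushout sq⟩
  · ext1
    exact sq.inl_desc _ _ w'
  · ext1
    rw [← cancel_mono (truncGEι a Z'), truncGEι_naturality, ObjectProperty.FullSubcategory.comp_hom,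
      Category.assoc, he]
    exact sq.w.symm
  · ext1
    rw [← cancel_mono (truncGEι a Y), ObjectProperty.FullSubcategory.comp_hom, Category.assoc,
      truncGEι_naturality, reassoc_of% he]
    exact sq.inr_desc _ _ w'

theorem liftsFactorizations_truncGE (hma : m ≤ a) :
    LiftsFactorizations (truncGEFunctor (A := A) m n a) := fun _ _ f _ g h w ↦ by
  obtain ⟨Z', g', h', e, hf, hg, hh, -⟩ := exists_factorization_of_truncGE hma f g h w
  exact ⟨Z', g', h', e, hf, hg, hh⟩

theorem exists_iso_truncLE {Z : FixedSize A m b} {K : FixedSize A m n} (φ : K.obj ⟶ Z.obj)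
    (hφ : ∀ i ≤ b, IsIso (φ.f i)) :
    ∃ e : (truncLEFunctor m n b).obj K ≅ Z, truncLEπ b K ≫ e.hom.hom = φ := by
  have hπ (i : ℤ) (hi : i ≤ b) := isIso_truncLEπ_f K hi
  obtain ⟨ψ, hψ⟩ := exists_desc_of_degreewise φ (truncLEπ b K)
    (fun i ↦ by
      rcases le_or_gt i b with hi | hi
      · have := hπ i hi
        exact ⟨inv ((truncLEπ b K).f i) ≫ φ.f i, by simp⟩
      · exact ⟨0, (isZero_X_of_gt Z hi).eq_of_tgt _ _⟩)
    (fun i j _ ↦ Or.inr inferInstance)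
  have : IsIso ψ := isIso_of_isIso_f_or_isZero ψ fun i ↦ by
    rcases le_or_gt i b with hi | hi
    · have := hπ i hi
      have : IsIso ((truncLEπ b K).f i ≫ ψ.f i) := by
        rw [← HomologicalComplex.comp_f, hψ]
        exact hφ i hi
      exact Or.inl (IsIso.of_isIso_comp_left ((truncLEπ b K).f i) _)
    · exact Or.inr ⟨isZero_X_of_gt _ hi, isZero_X_of_gt Z hi⟩
  exact ⟨ObjectProperty.isoMk _ (asIso ψ), hψ⟩

section Pullback

variable {Y : FixedSize A m n} {Z : FixedSize A m b}
  {h : Z.obj ⟶ ((truncLEFunctor m n b).obj Y).obj} {P : CochainComplex (ModuleCat.{u} A) ℤ}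
  {fst : P ⟶ Y.obj} {snd : P ⟶ Z.obj}

theorem isIso_snd_f_of_isPullback (sq : IsPullback fst snd (truncLEπ b Y) h) {i : ℤ}
    (hi : i ≤ b) : IsIso (snd.f i) :=
  (sq.map (HomologicalComplex.eval _ _ i)).isIso_snd_of_isIso (isIso_truncLEπ_f Y hi)

theorem isIso_fst_f_of_isPullback (sq : IsPullback fst snd (truncLEπ b Y) h) {i : ℤ}
    (hi : b < i) : IsIso (fst.f i) :=
  (sq.map (HomologicalComplex.eval _ _ i)).isIso_fst_of_isIso <|
    isIso_of_source_target_iso_zero _ (isZero_X_of_gt Z hi).isoZero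
      (isZero_X_of_gt ((truncLEFunctor m n b).obj Y) hi).isoZero

theorem isFixedSizeProj_of_isPullback (hbn : b ≤ n) (sq : IsPullback fst snd (truncLEπ b Y) h) :
    isFixedSizeProj A m n P := isFixedSizeProj_of_degreewise_retract fun i ↦ by
  rcases le_or_gt i b with hi | hi
  · have := isIso_snd_f_of_isPullback sq hi
    exact ⟨_, isFixedSizeProj_of_le le_rfl hbn Z.property, ⟨.ofIso (asIso (snd.f i))⟩⟩
  · have := isIso_fst_f_of_isPullback sq hi
    exact ⟨_, Y.property, ⟨.ofIso (asIso (fst.f i))⟩⟩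

end Pullback

theorem liftsFactorizations_truncLE (hbn : b ≤ n) :
    LiftsFactorizations (truncLEFunctor (A := A) m n b) := by
  intro X Y f Z g h w
  obtain ⟨P, fst, snd, sq⟩ : ∃ (P : _) (fst : P ⟶ Y.obj) (snd : P ⟶ Z.obj),
    IsPullback fst snd (truncLEπ b Y) h.hom := ⟨_, _, _, IsPullback.of_hasPullback _ _⟩
  have w' : f.hom ≫ truncLEπ b Y = (truncLEπ b X ≫ g.hom) ≫ h.hom := by
    rw [truncLEπ_naturality, ← w, ObjectProperty.FullSubcategory.comp_hom, Category.assoc]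
  let Z' : FixedSize A m n := ⟨P, isFixedSizeProj_of_isPullback hbn sq⟩
  let g' : X ⟶ Z' := ObjectProperty.homMk (sq.lift _ _ w')
  obtain ⟨e, he⟩ := exists_iso_truncLE (K := Z') snd fun _ ↦ isIso_snd_f_of_isPullback sq
  refine ⟨Z', g', ObjectProperty.homMk fst, e.symm, ?_, ?_, ?_⟩
  · ext1
    exact sq.lift_fst _ _ w'
  · rw [Iso.symm_hom, Iso.comp_inv_eq]
    ext1
    rw [← cancel_epi (truncLEπ b X), ObjectProperty.FullSubcategory.comp_hom,
      ← reassoc_of% (truncLEπ_naturality g'), he]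
    exact (sq.lift_snd _ _ w').symm
  · rw [Iso.symm_hom, Iso.inv_comp_eq]
    ext1
    rw [← cancel_epi (truncLEπ b Z'), ObjectProperty.FullSubcategory.comp_hom,
      ← truncLEπ_naturality, reassoc_of% he]
    exact sq.w

theorem isSplitMono_truncGE_map_or_isSplitEpi_f (hma : m ≤ a) {X Y : FixedSize A m n} {f : X ⟶ Y}
    (hf : IsIrreducibleHom f) :
    IsSplitMono ((truncGEFunctor m n a).map f) ∨ ∀ i < a, IsSplitEpi (f.hom.f i) := by
  obtain ⟨Z', g', h', e, rfl, hg, -, hg'⟩ := exists_factorization_of_truncGE hma f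
    ((truncGEFunctor m n a).map f) (𝟙 _) (Category.comp_id _)
  rcases hf.2.2 g' h' rfl with hs | hs
  · refine Or.inl ?_
    rw [(Iso.eq_comp_inv e).2 hg]
    infer_instance
  · refine Or.inr fun i hi ↦ ?_
    have := hg' i hi
    have : IsSplitEpi (h'.hom.f i) := inferInstanceAs <| IsSplitEpi <|
      ((isFixedSizeProj A m n).ι ⋙ HomologicalComplex.eval _ _ i).map h'
    exact inferInstanceAs (IsSplitEpi (g'.hom.f i ≫ h'.hom.f i))

end FixedSize

theorem bijective_comp_of_isCompl {A M N : Type*} [Ring A] [AddCommGroup M] [AddCommGroup N]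
    [Module A M] [Module A N] {p : M →ₗ[A] N} {i : N →ₗ[A] M} (hp : Function.Surjective p)
    (hi : Function.Injective i) (h : IsCompl (LinearMap.ker p) (LinearMap.range i)) :
    Function.Bijective (p ∘ₗ i) := by
  refine ⟨(injective_iff_map_eq_zero _).2 fun x hx ↦ ?_, fun y ↦ ?_⟩
  · exact (map_eq_zero_iff i hi).1 (Submodule.disjoint_def.1 h.disjoint _ hx ⟨x, rfl⟩)
  · obtain ⟨x, rfl⟩ := hp y
    obtain ⟨k, hk, _, ⟨z, rfl⟩, rfl⟩ :=
      Submodule.mem_sup.1 (h.sup_eq_top ▸ Submodule.mem_top : x ∈ _)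
    exact ⟨z, by rw [map_add, LinearMap.mem_ker.1 hk, zero_add, LinearMap.comp_apply]⟩

namespace FixedSize

variable {A : Type u} [Ring A] {m n : ℤ}

variable (A m n) in
/-- The functor sending a complex to its entry in degree `i`. -/
abbrev entry (i : ℤ) : FixedSize A m n ⥤ ModuleCat.{u} A :=
  (isFixedSizeProj A m n).ι ⋙ HomologicalComplex.eval _ _ i

section Size

variable [IsArtinianRing A]

theorem isFiniteLength_X (X : FixedSize A m n) (i : ℤ) : IsFiniteLength A (X.obj.X i) := by
  have := (X.property.1 i).1
  exact isFiniteLength_iff_isNoetherian_isArtinian.2 ⟨inferInstance, inferInstance⟩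

theorem length_X_ne_top (X : FixedSize A m n) (i : ℤ) : Module.length A (X.obj.X i) ≠ ⊤ :=
  Module.length_ne_top_iff.2 (isFiniteLength_X X i)

variable (A m n) in
/-- The sum of the lengths of the entries of a complex. -/
noncomputable def totalLength : AdditiveSize (FixedSize A m n) where
  size X := ∑ i ∈ Finset.Icc m n, (Module.length A (X.obj.X i)).toNat
  size_pos X hX := by
    contrapose! hX
    refine (isZero_iff X).2 fun i ↦ ?_
    by_cases hi : i ∈ Set.Icc m n
    · have h := Finset.sum_eq_zero_iff.1 (Nat.le_zero.1 hX) i (Finset.mem_Icc.2 hi)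
      have := Module.length_eq_zero_iff.1
        ((ENat.toNat_eq_zero.1 h).resolve_right (length_X_ne_top X i))
      exact ModuleCat.isZero_of_subsingleton _
    · exact X.property.2 i hi
  size_biprod {X Y Z} e := by
    rw [← Finset.sum_add_distrib]
    refine Finset.sum_congr rfl fun i _ ↦ ?_
    have := preservesBinaryBiproducts_of_preservesBiproducts (entry A m n i)
    let ei : X.obj.X i ≅ ModuleCat.of A (Y.obj.X i × Z.obj.X i) :=
      (entry A m n i).mapIso e ≪≫ (entry A m n i).mapBiprod Y Z ≪≫ ModuleCat.biprodIsoProd _ _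
    rw [← ENat.toNat_add (length_X_ne_top Y i) (length_X_ne_top Z i),
      ← Module.length_prod, ei.toLinearEquiv.length_eq]

end Size

section Fitting

theorem exists_isCompl_ker_range_pow [IsArtinianRing A] {X : FixedSize A m n} (θ : End X) :
    ∃ N : ℕ, N ≠ 0 ∧ ∀ i, IsCompl (LinearMap.ker ((θ ^ N : End X).hom.f i).hom)
      (LinearMap.range ((θ ^ N : End X).hom.f i).hom) := by
  have hpow (N : ℕ) (i : ℤ) :
      ((θ ^ N : End X).hom.f i).hom = (θ.hom.f i).hom ^ N := by
    exact map_pow ((ModuleCat.endRingEquiv (X.obj.X i)).toMonoidHom.comp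
      ((entry A m n i).mapEnd X)) θ N
  have h (i : ℤ) : ∀ᶠ N : ℕ in Filter.atTop, IsCompl
      (LinearMap.ker ((θ.hom.f i).hom ^ N)) (LinearMap.range ((θ.hom.f i).hom ^ N)) := by
    obtain ⟨_, _⟩ := isFiniteLength_iff_isNoetherian_isArtinian.1 (isFiniteLength_X X i)
    exact LinearMap.eventually_isCompl_ker_pow_range_pow _
  obtain ⟨N, hN, hc⟩ := ((Filter.eventually_ne_atTop 0).and
    ((Filter.eventually_all_finset (Finset.Icc m n)).2 fun i _ ↦ h i)).exists
  refine ⟨N, hN, fun i ↦ ?_⟩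
  by_cases hi : i ∈ Set.Icc m n
  · rw [hpow]
    exact hc i (Finset.mem_Icc.2 hi)
  · have := ModuleCat.subsingleton_of_isZero (X.property.2 i hi)
    exact ⟨disjoint_iff.2 (Subsingleton.elim _ _), codisjoint_iff.2 (Subsingleton.elim _ _)⟩

theorem isIso_or_eq_zero_of_isCompl {X : FixedSize A m n} (hX : Indecomposable X) (φ : X ⟶ X)
    (h : ∀ i, IsCompl (LinearMap.ker (φ.hom.f i).hom) (LinearMap.range (φ.hom.f i).hom)) :
    IsIso φ ∨ φ = 0 := by
  obtain ⟨K, p, i, hp, hi, hpi⟩ : ∃ (K : CochainComplex (ModuleCat.{u} A) ℤ) (p : X.obj ⟶ K)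
      (i : K ⟶ X.obj), Epi p ∧ Mono i ∧ p ≫ i = φ.hom :=
    ⟨_, factorThruImage φ.hom, image.ι φ.hom, inferInstance, inferInstance, image.fac φ.hom⟩
  have hip : IsIso (i ≫ p) := by
    have (j : ℤ) : IsIso ((i ≫ p).f j) := by
      have hpj := (ModuleCat.epi_iff_surjective (p.f j)).1 inferInstance
      have hij := (ModuleCat.mono_iff_injective (i.f j)).1 inferInstance
      refine (ConcreteCategory.isIso_iff_bijective _).2 (bijective_comp_of_isCompl hpj hij ?_)
      have hj := h j
      rw [← hpi, HomologicalComplex.comp_f, ModuleCat.hom_comp] at hj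
      rwa [LinearMap.range_comp_of_range_eq_top _ (LinearMap.range_eq_top.2 hpj),
        LinearMap.ker_comp_of_ker_eq_bot _ (LinearMap.ker_eq_bot.2 hij)] at hj
    exact HomologicalComplex.Hom.isIso_of_components _
  have hK : isFixedSizeProj A m n K := ObjectProperty.prop_of_retract _
    ⟨i, p ≫ inv (i ≫ p), by rw [← Category.assoc, IsIso.hom_inv_id]⟩ X.property
  let I : FixedSize A m n := ⟨K, hK⟩
  let p' : X ⟶ I := ObjectProperty.homMk p
  let i' : I ⟶ X := ObjectProperty.homMk i
  obtain rfl : p' ≫ i' = φ := by ext1; exact hpi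
  have : IsIso (i' ≫ p') :=
    (isIso_iff_of_reflects_iso (i' ≫ p') (isFixedSizeProj A m n).ι).1 hip
  exact isIso_or_eq_zero_of_isIso_comp hX p' i'

theorem isIso_or_isNilpotent [IsArtinianRing A] {X : FixedSize A m n} (hX : Indecomposable X)
    (θ : End X) : IsIso (θ : X ⟶ X) ∨ IsNilpotent θ := by
  obtain ⟨N, hN, hc⟩ := exists_isCompl_ker_range_pow θ
  refine (isIso_or_eq_zero_of_isCompl hX (θ ^ N : End X) hc).imp (fun h ↦ ?_) fun h ↦ ⟨N, h⟩
  exact (isUnit_iff_isIso θ).1 ((isUnit_pow_iff hN).1 ((isUnit_iff_isIso _).2 h))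

end Fitting

end FixedSize

theorem IsStalk.isZero_X {A : Type u} [Ring A] {m n : ℤ} {X : FixedSize A m n} (hX : IsStalk X)
    {i : ℤ} (hi : ¬ IsZero (X.obj.X i)) {j : ℤ} (hj : j ≠ i) : IsZero (X.obj.X j) := by
  obtain ⟨k, -, hk⟩ := hX
  obtain rfl : i = k := not_imp_comm.1 (hk i) hi
  exact hk j hj

namespace FixedSize

variable {A : Type u} [Ring A] {m n : ℤ}

section Stalk

variable {X : FixedSize A m n}

theorem isStalkInjective_of_isZero_X (hXm : ¬ IsZero (X.obj.X m))
    (h : ∀ i ≠ m, IsZero (X.obj.X i)) : IsStalkInjective X := by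
  refine ⟨⟨m, hXm, h⟩, fun U V s hs g ↦ ?_⟩
  obtain ⟨ψ, hψ⟩ := exists_desc_of_degreewise g.hom s.hom
    (fun i ↦ by
      have := hs i
      exact ⟨retraction (s.hom.f i) ≫ g.hom.f i, IsSplitMono.id_assoc _ _⟩)
    (fun i j (hij : i + 1 = j) ↦ by
      rcases eq_or_ne j m with hj | hj
      · exact Or.inr ⟨fun _ _ _ ↦ (isZero_X_of_lt V (by omega)).eq_of_src _ _⟩
      · exact Or.inl (h j hj))
  exact ⟨ObjectProperty.homMk ψ, by ext1; exact hψ⟩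

theorem isZero_X_of_d_eq_zero (hX : Indecomposable X) {i : ℤ} (hi : ¬ IsZero (X.obj.X i))
    (hto : ∀ j, X.obj.d j i = 0) (hfrom : ∀ j, X.obj.d i j = 0) {j : ℤ} (hj : j ≠ i) :
    IsZero (X.obj.X j) := by
  let s : Retract ((HomologicalComplex.single _ _ i).obj (X.obj.X i)) X.obj :=
    { i := HomologicalComplex.mkHomFromSingle (𝟙 _) fun k _ ↦ by rw [hfrom, comp_zero]
      r := HomologicalComplex.mkHomToSingle (𝟙 _) fun k _ ↦ by rw [hto, zero_comp]
      retract := by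
        ext
        simp }
  let S : FixedSize A m n := ⟨_, ObjectProperty.prop_of_retract _ s X.property⟩
  let t : Retract S X := ⟨ObjectProperty.homMk s.i, ObjectProperty.homMk s.r, by
    ext1
    exact s.retract⟩
  rcases isZero_or_isIso_of_retract hX t with hS | (hs : IsIso t.i)
  · exact absurd (((isZero_iff S).1 hS i).of_iso
      (HomologicalComplex.singleObjXSelf _ i _).symm) hi
  · have hS : IsZero (S.obj.X j) := HomologicalComplex.isZero_single_obj_X _ i _ j hj
    exact hS.of_iso ((entry A m n j).mapIso (asIso t.i)).symm

theorem isZero_X_of_isZero_X_succ (hX : Indecomposable X) (hXm : ¬ IsZero (X.obj.X m))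
    (h : IsZero (X.obj.X (m + 1))) {i : ℤ} (hi : i ≠ m) : IsZero (X.obj.X i) := by
  refine isZero_X_of_d_eq_zero hX hXm (fun j ↦ ?_) (fun j ↦ ?_) hi
  · by_cases hj : j + 1 = m
    · exact (isZero_X_of_lt X (by omega)).eq_of_src _ _
    · exact X.obj.shape _ _ hj
  · by_cases hj : m + 1 = j
    · exact (hj ▸ h).eq_of_tgt _ _
    · exact X.obj.shape _ _ hj

end Stalk

section TruncLE

variable {b : ℤ} {X Y : FixedSize A m n}

theorem isZero_truncLE_X_iff {i : ℤ} (hi : i ≤ b) :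
    IsZero (((truncLEFunctor m n b).obj X).obj.X i) ↔ IsZero (X.obj.X i) := by
  have := isIso_truncLEπ_f X hi
  exact (asIso ((truncLEπ b X).f i)).isZero_iff.symm

theorem isIso_truncLEπ (h : ∀ i > b, IsZero (X.obj.X i)) : IsIso (truncLEπ b X) :=
  isIso_of_isIso_f_or_isZero _ fun i ↦ by
    rcases le_or_gt i b with hi | hi
    · exact Or.inl (isIso_truncLEπ_f X hi)
    · exact Or.inr ⟨h i hi, isZero_X_of_gt _ hi⟩

theorem isSplitMono_of_truncLE (hX : ∀ i > b, IsZero (X.obj.X i)) (f : X ⟶ Y)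
    [IsSplitMono ((truncLEFunctor m n b).map f)] : IsSplitMono f := by
  have := isIso_truncLEπ hX
  let r := (retraction ((truncLEFunctor m n b).map f)).hom
  have hr : ((truncLEFunctor m n b).map f).hom ≫ r = 𝟙 _ :=
    congrArg (·.hom) (IsSplitMono.id ((truncLEFunctor m n b).map f))
  refine ⟨⟨ObjectProperty.homMk (truncLEπ b Y ≫ r ≫ inv (truncLEπ b X)), ?_⟩⟩
  ext1
  change f.hom ≫ truncLEπ b Y ≫ r ≫ inv (truncLEπ b X) = 𝟙 _
  rw [reassoc_of% (truncLEπ_naturality f), reassoc_of% hr, IsIso.hom_inv_id]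

theorem isSplitEpi_of_truncLE (hY : ∀ i ≥ b, IsZero (Y.obj.X i)) (f : X ⟶ Y)
    [IsSplitEpi ((truncLEFunctor m n b).map f)] : IsSplitEpi f := by
  have := isIso_truncLEπ fun i hi ↦ hY i hi.le
  let s := (section_ ((truncLEFunctor m n b).map f)).hom
  have hs : s ≫ ((truncLEFunctor m n b).map f).hom = 𝟙 _ :=
    congrArg (·.hom) (IsSplitEpi.id ((truncLEFunctor m n b).map f))
  obtain ⟨ψ, hψ⟩ := exists_lift_of_degreewise (truncLEπ b Y ≫ s) (truncLEπ b X)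
    (fun i ↦ by
      rcases le_or_gt i b with hi | hi
      · have := isIso_truncLEπ_f X hi
        exact ⟨(truncLEπ b Y ≫ s).f i ≫ inv ((truncLEπ b X).f i), by simp⟩
      · exact ⟨0, (hY i hi.le).eq_of_src _ _⟩)
    (fun i j (hij : i + 1 = j) ↦ by
      rcases lt_or_ge i b with hi | hi
      · have := isIso_truncLEπ_f X (show j ≤ b by omega)
        exact Or.inr inferInstance
      · exact Or.inl (hY i hi))
  refine ⟨⟨ObjectProperty.homMk ψ, ?_⟩⟩
  ext1
  change ψ ≫ f.hom = 𝟙 _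
  rw [← cancel_mono (truncLEπ b Y), Category.assoc, truncLEπ_naturality, reassoc_of% hψ, hs,
    Category.comp_id, Category.id_comp]

theorem isIrreducibleHom_truncLE (hmb : m < b) (hbn : b ≤ n) (hX : Indecomposable X)
    (hY : Indecomposable Y) (hXm : ¬ IsZero (X.obj.X m)) (hYm : ¬ IsZero (Y.obj.X m)) {f : X ⟶ Y}
    (hf : IsIrreducibleHom f) (h : IsStalk X ∨ IsStalk Y) :
    IsIrreducibleHom ((truncLEFunctor m n b).map f) := by
  set F := truncLEFunctor (A := A) m n b
  refine hf.map (liftsFactorizations_truncLE hbn) (fun hm ↦ hf.1 ?_) fun he ↦ hf.2.1 ?_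
  · have hX' : ∀ i ≠ m, IsZero (X.obj.X i) := by
      rcases h with h | h
      · exact fun i ↦ h.isZero_X hXm
      · have hY1 := (isZero_truncLE_X_iff hmb).2 (h.isZero_X hYm (by omega))
        have hX1 := hY1.of_mono ((entry A m b (m + 1)).map (F.map f))
        exact fun i ↦ isZero_X_of_isZero_X_succ hX hXm ((isZero_truncLE_X_iff hmb).1 hX1)
    exact isSplitMono_of_truncLE (b := b) (fun i hi ↦ hX' i (by omega)) f
  · have hY' : ∀ i ≠ m, IsZero (Y.obj.X i) := by
      rcases h with h | h
      · have hX1 := (isZero_truncLE_X_iff hmb).2 (h.isZero_X hXm (by omega))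
        have hY1 := hX1.of_epi ((entry A m b (m + 1)).map (F.map f))
        exact fun i ↦ isZero_X_of_isZero_X_succ hY hYm ((isZero_truncLE_X_iff hmb).1 hY1)
      · exact fun i ↦ h.isZero_X hYm
    exact isSplitEpi_of_truncLE (b := b) (fun i hi ↦ hY' i (by omega)) f

end TruncLE

section TruncGE

variable {a : ℤ} {X Y : FixedSize A m n}

instance : (truncGEFunctor (A := A) m n a).PreservesZeroMorphisms where
  map_zero X Y := by
    ext1
    rw [← cancel_mono (truncGEι a Y), truncGEι_naturality]
    exact comp_zero.trans zero_comp.symm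

theorem isZero_X_of_isZero_truncGE (h : IsZero ((truncGEFunctor m n a).obj X)) {i : ℤ}
    (hi : a ≤ i) : IsZero (X.obj.X i) := by
  have := isIso_truncGEι_f X hi
  exact ((isZero_iff _).1 h i).of_iso (asIso ((truncGEι a X).f i)).symm

variable [IsArtinianRing A]

theorem isEmpty_iso_of_isIrreducibleHom (hma : m ≤ a) (hX : Indecomposable X)
    (hXa : ¬ IsZero ((truncGEFunctor m n a).obj X)) {i : ℤ} (hi : i < a)
    (hXi : ¬ IsZero (X.obj.X i)) {f : X ⟶ Y} (hf : IsIrreducibleHom f) : IsEmpty (X ≅ Y) := by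
  refine ⟨fun e ↦ ?_⟩
  let θ : End X := f ≫ e.inv
  rcases isIso_or_isNilpotent hX θ with (h : IsIso (f ≫ e.inv)) | hθ
  · have : IsIso f := IsIso.of_isIso_comp_right f e.inv
    exact hf.1 inferInstance
  rcases isSplitMono_truncGE_map_or_isSplitEpi_f hma hf with h | h
  · let F := truncGEFunctor (A := A) m n a
    refine hXa (isZero_of_isNilpotent_of_mono (θ := F.mapEnd X θ) ?_ ?_)
    · exact isNilpotent_mapEnd F hθ
    · change Mono (F.map (f ≫ e.inv))
      rw [F.map_comp]
      infer_instance
  · let E := entry A m n i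
    have hE : IsSplitEpi (E.map f) := h i hi
    refine hXi (isZero_of_isNilpotent_of_epi (θ := E.mapEnd X θ) ?_ ?_)
    · exact isNilpotent_mapEnd E hθ
    · change Epi (E.map (f ≫ e.inv))
      rw [E.map_comp]
      infer_instance

theorem exists_common_retract_or_isRadicalIrreducible (hma : m ≤ a)
    (hX : ¬ IsZero ((truncGEFunctor m n a).obj X)) (hY : ¬ IsZero ((truncGEFunctor m n a).obj Y))
    {f : X ⟶ Y} (hf : IsIrreducibleHom f) :
    (∃ W, Indecomposable W ∧ Nonempty (Retract W ((truncGEFunctor m n a).obj X)) ∧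
      Nonempty (Retract W ((truncGEFunctor m n a).obj Y))) ∨
    (IsRadicalIrreducible ((truncGEFunctor m n a).map f) ∧ ∀ i < a, IsSplitEpi (f.hom.f i)) := by
  set F := truncGEFunctor (A := A) m n a
  by_cases hm : IsSplitMono (F.map f)
  · obtain ⟨W, hW, ⟨s⟩⟩ := (totalLength A a n).exists_indecomposable_retract hX
    exact Or.inl ⟨W, hW, ⟨s⟩, ⟨s.trans ⟨F.map f, retraction (F.map f), IsSplitMono.id _⟩⟩⟩
  by_cases he : IsSplitEpi (F.map f)
  · obtain ⟨W, hW, ⟨s⟩⟩ := (totalLength A a n).exists_indecomposable_retract hY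
    exact Or.inl ⟨W, hW, ⟨s.trans ⟨section_ (F.map f), F.map f, IsSplitEpi.id _⟩⟩, ⟨s⟩⟩
  by_cases hr : F.map f ∈ radicalHom (F.obj X) (F.obj Y)
  · exact Or.inr ⟨⟨hr, hf.map (liftsFactorizations_truncGE hma) hm he⟩,
      (isSplitMono_truncGE_map_or_isSplitEpi_f hma hf).resolve_left hm⟩
  · exact Or.inl ((totalLength A a n).exists_common_retract_of_notMem_radicalHom hr)

end TruncGE

end FixedSize

open FixedSize in
theorem proposition2p6_general {A : Type u} [Ring A] [IsArtinianRing A] (n : ℤ) (hn : 2 ≤ n)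
    (X Y : FixedSize A 0 n) (hX : Indecomposable X) (hY : Indecomposable Y)
    (hX0 : ¬ IsZero (X.obj.X 0)) (hY0 : ¬ IsZero (Y.obj.X 0))
    (f : X ⟶ Y) (hf : IsIrreducibleHom f) :
    (¬ IsStalkInjective X → ¬ IsStalkInjective Y →
      (∃ W : FixedSize A 1 n, Indecomposable W ∧
        IsLeftEnlargement W X ∧ IsLeftEnlargement W Y ∧ IsEmpty (X ≅ Y)) ∨
      (IsRadicalIrreducible ((functorF n).map f) ∧ IsSplitEpi (f.hom.f 0))) ∧
    (IsStalkInjective X ∨ IsStalkInjective Y → IsIrreducibleHom ((functorG n).map f)) := by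
  refine ⟨fun hXs hYs ↦ ?_, fun h ↦ isIrreducibleHom_truncLE (by omega) (by omega) hX hY hX0 hY0
    hf (h.imp And.left And.left)⟩
  have hF (Z : FixedSize A 0 n) (hZ0 : ¬ IsZero (Z.obj.X 0)) (hZ : ¬ IsStalkInjective Z) :
      ¬ IsZero ((functorF n).obj Z) := fun h ↦
    hZ <| isStalkInjective_of_isZero_X hZ0 fun i hi ↦ by
      rcases hi.lt_or_gt with hi | hi
      · exact isZero_X_of_lt Z hi
      · exact isZero_X_of_isZero_truncGE h hi
  have hXF := hF X hX0 hXs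
  refine (exists_common_retract_or_isRadicalIrreducible zero_le_one hXF (hF Y hY0 hYs) hf).imp
    ?_ fun ⟨hr, he⟩ ↦ ⟨hr, he 0 one_pos⟩
  rintro ⟨W, hW, ⟨sX⟩, ⟨sY⟩⟩
  exact ⟨W, hW, ⟨hW, hX, hX0, isDirectSummand_of_retract sX⟩,
    ⟨hW, hY, hY0, isDirectSummand_of_retract sY⟩,
    isEmpty_iso_of_isIrreducibleHom zero_le_one hX hXF one_pos hX0 hf⟩

theorem proposition2p6
    {R : Type w} [CommRing R] [IsArtinianRing R]
    {A : Type u} [Ring A] [Algebra R A] [Module.Finite R A]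
    (n : ℤ) (hn : 2 ≤ n)
    (X Y : FixedSize A 0 n) (hX : Indecomposable X) (hY : Indecomposable Y)
    (hX0 : ¬ IsZero (X.obj.X 0)) (hY0 : ¬ IsZero (Y.obj.X 0))
    (f : X ⟶ Y) (hf : IsIrreducibleHom f) :
    (¬ IsStalkInjective X → ¬ IsStalkInjective Y →
      (∃ W : FixedSize A 1 n, Indecomposable W ∧
        IsLeftEnlargement W X ∧ IsLeftEnlargement W Y ∧ IsEmpty (X ≅ Y)) ∨
      (IsRadicalIrreducible ((functorF n).map f) ∧ IsSplitEpi (f.hom.f 0))) ∧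
    (IsStalkInjective X ∨ IsStalkInjective Y → IsIrreducibleHom ((functorG n).map f)) := by
  have : IsArtinianRing A := isArtinian_of_tower R inferInstance
  exact proposition2p6_general n hn X Y hX hY hX0 hY0 f hf
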